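/- \textbf{Setting.} Let $\mathcal X,\mathcal Y,\mathcal S$ be finite nonempty sets (instructions, responses, contexts), and let $\mathbb P(\cdot\mid y,s)$ be a probability distribution on $\mathcal X$ for each $y\in\mathcal Y$, $s\in\mathcal S$ (the teacher). In each round $t=1,2,\dots$ the world presents a context $s_t\in\mathcal S$ and an instruction $x_t\in\mathcal X$, chosen arbitrarily (possibly at random, adversarially and adaptively) depending on the past; the agent generates a response $y_t\in\mathcal Y$; and the teacher returns a hindsight instruction $x'_t$ which, conditionally on everything that happened before (including $s_t,x_t,y_t$), has law $\mathbb P(\cdot\mid y_t,s_t)$. The regret is $$\mathrm{Reg}(T)=\sum_{t=1}^T\Bigl(\max_{y\in\mathcal Y}\mathbb P(x_t\mid y,s_t)-\mathbb P(x_t\mid y_t,s_t)\Bigr).$$ \textbf{Assumptions.} Let $g^\star:\mathcal Y\times\mathcal S\to\mathbb R^d$, let $\mathcal F$ be a finite set of functions $\mathcal X\to\mathbb R^d$, and let $B>0$, $\delta\in(0,1)$. (i) Realizability: there is $f^\star\in\mathcal F$ with $\mathbb P(x\mid y,s)=f^\star(x)^\top g^\star(y,s)$ for all $x,y,s$, and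 for all $f\in\mathcal F$, $y\in\mathcal Y$, $s\in\mathcal S$ the function $x\mapsto f(x)^\top g^\star(y,s)$ is a probability distribution on $\mathcal X$. (ii) Boundedness: $\|f(x)\|_2\le B$ and $\|g^\star(y,s)\|_2\le B$ for all $f\in\mathcal F$, $x\in\mathcal X$, $y\in\mathcal Y$, $s\in\mathcal S$. \textbf{Algorithm (LORIL with bonus constant $C'$).} Put $\lambda_t=1/t$ and $\|v\|_A=\sqrt{v^\top Av}$. In round $t$ let $$\hat f_t\in\arg\max_{f\in\mathcal F}\sum_{\ell=1}^{t-1}\ln\bigl(f(x'_\ell)^\top g^\star(y_\ell,s_\ell)\bigr),\qquad \widehat\Sigma_t=\lambda_t I+\sum_{\ell=1}^{t-1}g^\star(y_\ell,s_\ell)g^\star(y_\ell,s_\ell)^\top,$$ with $\ln 0=-\infty$, let $$b_t(y,s)=C'\Bigl(\sqrt{\log(t|\mathcal F|/\delta)}+\sqrt{\lambda_t}\,B\Bigr)\|g^\star(y,s)\|_{\widehat\Sigma_t^{-1}},$$ and play $y_t\in\arg\max_{y\in\mathcal Y}\bigl(\hat f_t(x_t)^\top g^\star(y,s_t)+b_t(y,s_t)\bigr)$.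 Ties are broken arbitrarily. \textbf{Theorem (regret bound of LORIL).} There is an absolute constant $C_0>0$ such that for every $C'\ge C_0$ there is a constant $K>0$ depending only on $C'$ with the following property. In every setting as above in which (i) and (ii) hold, if the agent runs LORIL with bonus constant $C'$, then with probability at least $1-3\delta$, simultaneously for all integers $T\ge1$, $$\mathrm{Reg}(T)\le K\Bigl(B\sqrt{Td\log(1+TB)}+\sqrt{Td\,\log(T|\mathcal F|/\delta)\,\log(1+TB)}\Bigr).$$ In particular, the bound does not depend on $|\mathcal X|$, $|\mathcal Y|$ or $|\mathcal S|$. -/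

import Mathlib

open MeasureTheory

namespace LORIL

noncomputable section

/-- The random variables of an interaction over the rounds `t = 1, 2, 3, …` (the index `0` is not
used): in round `t` the world presents the context `s t` and the instruction `x t`, the agent
generates the response `y t`, and the teacher answers with the hindsight instruction `x' t`. -/
structure Interaction (X Y S Ω : Type*) where
  /-- contexts -/
  s : ℕ → Ω → S
  /-- instructions -/
  x : ℕ → Ω → X
  /-- responses of the agent -/
  y : ℕ → Ω → Y
  /-- hindsight instructions of the teacher -/
  x' : ℕ → Ω → X

/-- The protocol of learning from hindsight instruction with teacher `P(· | y, s) = P y s`.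
The σ-algebra `ℱ t` is the information available right before the teacher answers in round `t`:
it contains `s ℓ, x ℓ, y ℓ` for `ℓ ≤ t` and `x' ℓ` for `ℓ < t`, and possibly further
randomness of the world or of the agent. Given `ℱ t`, the hindsight instruction `x' t` is
distributed as `P(· | y t, s t)`. The way in which the world chooses `s t, x t` given the past
is not restricted (it may be adversarial and adaptive). -/
structure IsProtocol {X Y S Ω : Type*} [MeasurableSpace X] [MeasurableSpace Y] [MeasurableSpace S]
    {mΩ : MeasurableSpace Ω} (μ : Measure Ω) (ℱ : Filtration ℕ mΩ) (P : Y → S → PMF X)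
    (I : Interaction X Y S Ω) : Prop where
  measurable_s : ∀ t, 1 ≤ t → Measurable[ℱ t] (I.s t)
  measurable_x : ∀ t, 1 ≤ t → Measurable[ℱ t] (I.x t)
  measurable_y : ∀ t, 1 ≤ t → Measurable[ℱ t] (I.y t)
  measurable_x' : ∀ t, 1 ≤ t → Measurable[ℱ (t + 1)] (I.x' t)
  teacher : ∀ t, 1 ≤ t → ∀ a : X,
    μ[(I.x' t ⁻¹' {a}).indicator (fun _ => (1 : ℝ)) | ℱ t]
      =ᵐ[μ] fun ω => (P (I.y t ω) (I.s t ω) a).toReal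

/-- Realizability: the teacher is `P(x | y, s) = f⋆(x)ᵀ g(y, s)` for some `f⋆ ∈ F`, and every
`f ∈ F` defines a probability distribution `f(·)ᵀ g(y, s)` on `X` for all `y, s`. -/
def Realizable {X Y S : Type*} [Fintype X] {d : ℕ} (P : Y → S → PMF X)
    (F : Finset (X → EuclideanSpace ℝ (Fin d))) (g : Y → S → EuclideanSpace ℝ (Fin d)) : Prop :=
  (∃ fstar ∈ F, ∀ s x y, (P y s x).toReal = inner ℝ (fstar x) (g y s)) ∧
  ∀ f ∈ F, ∀ y s, (∀ x, 0 ≤ inner ℝ (f x) (g y s)) ∧ ∑ x, inner ℝ (f x) (g y s) = 1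

/-- All feature vectors have Euclidean norm at most `B`. -/
def BoundedFeatures {X Y S : Type*} {d : ℕ} (B : ℝ)
    (F : Finset (X → EuclideanSpace ℝ (Fin d))) (g : Y → S → EuclideanSpace ℝ (Fin d)) : Prop :=
  (∀ f ∈ F, ∀ x, ‖f x‖ ≤ B) ∧ ∀ y s, ‖g y s‖ ≤ B

/-- The norm `‖v‖_A = √(vᵀ A v)`. -/
def matNorm {d : ℕ} (A : Matrix (Fin d) (Fin d) ℝ) (v : EuclideanSpace ℝ (Fin d)) : ℝ :=
  √(v.ofLp ⬝ᵥ A.mulVec v.ofLp)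

/-- The regularizer `λ_t = 1 / t`. -/
def lam (t : ℕ) : ℝ := 1 / (t : ℝ)

namespace Interaction

variable {X Y S Ω : Type*} {d : ℕ}

/-- The log-likelihood `∑_{ℓ < t} ln (f(x'_ℓ)ᵀ g(y_ℓ, s_ℓ))` of the data collected before round
`t`, as an extended real number (with `ln 0 = -∞`). -/
def logLikelihood (I : Interaction X Y S Ω) (g : Y → S → EuclideanSpace ℝ (Fin d)) (t : ℕ) (ω : Ω)
    (f : X → EuclideanSpace ℝ (Fin d)) : EReal :=
  ∑ ℓ ∈ Finset.Ico 1 t,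
    ENNReal.log (ENNReal.ofReal (inner ℝ (f (I.x' ℓ ω)) (g (I.y ℓ ω) (I.s ℓ ω))))

/-- The regularized empirical covariance matrix
`λ_t I + ∑_{ℓ < t} g(y_ℓ, s_ℓ) g(y_ℓ, s_ℓ)ᵀ`. -/
def sigmaHat (I : Interaction X Y S Ω) (g : Y → S → EuclideanSpace ℝ (Fin d)) (t : ℕ) (ω : Ω) :
    Matrix (Fin d) (Fin d) ℝ :=
  lam t • (1 : Matrix (Fin d) (Fin d) ℝ) +
    ∑ ℓ ∈ Finset.Ico 1 t,
      Matrix.vecMulVec (g (I.y ℓ ω) (I.s ℓ ω)).ofLp (g (I.y ℓ ω) (I.s ℓ ω)).ofLp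

/-- The elliptic bonus
`b_t(y, s) = C' (√(log (t |F| / δ)) + √λ_t B) ‖g(y, s)‖_{Σ̂_t⁻¹}`, where `N = |F|`. -/
def bonus (I : Interaction X Y S Ω) (g : Y → S → EuclideanSpace ℝ (Fin d)) (C' B δ : ℝ) (N : ℕ)
    (t : ℕ) (ω : Ω) (y : Y) (s : S) : ℝ :=
  C' * (√(Real.log (t * N / δ)) + √(lam t) * B) * matNorm (I.sigmaHat g t ω)⁻¹ (g y s)

/-- The responses are generated by LORIL with bonus constant `C'`: in every round `t` there is a
maximum likelihood estimate `fhat t` over `F`, and the response maximizes the estimated model value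
plus the bonus. Ties are broken arbitrarily in both maximizations. -/
def IsLORIL (I : Interaction X Y S Ω) (F : Finset (X → EuclideanSpace ℝ (Fin d)))
    (g : Y → S → EuclideanSpace ℝ (Fin d)) (C' B δ : ℝ) : Prop :=
  ∃ fhat : ℕ → Ω → X → EuclideanSpace ℝ (Fin d), ∀ t, 1 ≤ t → ∀ ω,
    fhat t ω ∈ F ∧
    (∀ f ∈ F, I.logLikelihood g t ω f ≤ I.logLikelihood g t ω (fhat t ω)) ∧
    ∀ y : Y,
      inner ℝ (fhat t ω (I.x t ω)) (g y (I.s t ω)) +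
          I.bonus g C' B δ F.card t ω y (I.s t ω) ≤
        inner ℝ (fhat t ω (I.x t ω)) (g (I.y t ω) (I.s t ω)) +
          I.bonus g C' B δ F.card t ω (I.y t ω) (I.s t ω)

/-- The regret `Reg(T) = ∑_{t=1}^T (max_y P(x_t | y, s_t) - P(x_t | y_t, s_t))`. -/
def regret [Fintype Y] [Nonempty Y] (I : Interaction X Y S Ω) (P : Y → S → PMF X) (T : ℕ)
    (ω : Ω) : ℝ :=
  ∑ t ∈ Finset.Icc 1 T,
    (Finset.univ.sup' Finset.univ_nonempty (fun y : Y => (P y (I.s t ω) (I.x t ω)).toReal) -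
      (P (I.y t ω) (I.s t ω) (I.x t ω)).toReal)

end Interaction

end

end LORIL

/-!
The responses of LORIL are optimistic, so the regret of a round is at most twice the bonus of the
response played, as long as the bonus dominates the error of the estimated model; the bonuses then
sum up by the elliptic potential lemma.

*Confidence.* Write `p_f = f(·)ᵀ g(y, s)`. The root of the likelihood ratio `√(p_f / p_⋆)` has mean
`z = ∑ √(p_f p_⋆)` (the Hellinger affinity) under the teacher, and `z exp (1 - z) ≤ 1`. Hence the
product over the past rounds of `√(p_f / p_⋆) exp (1 - z)` is a nonnegative supermartingale started
at one (`IsProtocol.supermartingale_prod`), and by Ville's inequality and a union bound over `F` it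
stays below `|F| / δ` at all times and for all `f` with high probability. For the maximum likelihood
estimate the likelihood ratio is at least one, so the sum of `1 - z` over the past is at most
`log (|F| / δ)`. Since `(p x - q x)² ≤ 8 (1 - z)` at every point `x` (`sq_sub_le_affinity`), the
vector `f̂_t(x) - f⋆(x)` is small in the norm of the empirical covariance, at every instruction `x`
and without a dependence on `|X|` (`one_sub_le_measureReal_confidenceEvent`). The duality of the
norms `‖·‖_Σ` and `‖·‖_{Σ⁻¹}` turns this into the bonus (`abs_inner_sub_le_bonus`).

*Summation.* The regularizer `λ_t` decreases with `t`. For a fixed horizon `T`, replacing every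
`λ_t` by `λ_T` only increases the norms `‖g(y_t, s_t)‖_{Σ̂_t⁻¹}` (`matNorm_inv_le_of_le`), and the
elliptic potential lemma with a constant regularizer applies (`sum_min_one_sq_matNorm_le`). Only the
first round needs separate care, since the factor in front of the norm may be small there; its
regret is at most `min {1, B²}` (`sum_le_of_potential`).
-/

/-! ### Ville's inequality and likelihood-ratio supermartingales -/

/-- **Ville's inequality**: the probability that a nonnegative supermartingale ever reaches the
level `c` is at most its initial mean divided by `c`. -/
theorem MeasureTheory.Supermartingale.mul_measureReal_exists_ge_le {Ω : Type*}
    {mΩ : MeasurableSpace Ω} {μ : Measure Ω} [IsFiniteMeasure μ] {ℱ : Filtration ℕ mΩ}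
    {W : ℕ → Ω → ℝ} (hW : Supermartingale W ℱ μ) (hnonneg : ∀ t ω, 0 ≤ W t ω) (c : ℝ) :
    c * μ.real {ω | ∃ t, c ≤ W t ω} ≤ ∫ ω, W 0 ω ∂μ := by
  have hfin : ∀ n : ℕ, c * μ.real {ω | ∃ t ≤ n, c ≤ W t ω} ≤ ∫ ω, W 0 ω ∂μ := by
    intro n
    rcases le_or_gt c 0 with hc | hc
    · exact (mul_nonpos_of_nonpos_of_nonneg hc measureReal_nonneg).trans
        (integral_nonneg (hnonneg 0))
    set τ : Ω → ℕ∞ := fun ω => (hittingBtwn W {y : ℝ | c ≤ y} 0 n ω : ℕ)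
    have hτst : IsStoppingTime ℱ τ :=
      hW.stronglyAdapted.adapted.isStoppingTime_hittingBtwn measurableSet_Ici
    have hle : ∀ ω, τ ω ≤ n := fun ω => Nat.cast_le.2 (hittingBtwn_le ω)
    have h1 : ∫ ω, stoppedValue W τ ω ∂μ ≤ ∫ ω, W 0 ω ∂μ := by
      have h := hW.neg.expected_stoppedValue_mono (isStoppingTime_const ℱ 0) hτst
        (fun ω => zero_le (a := τ ω)) hle
      have e : stoppedValue (-W) τ = fun ω => -stoppedValue W τ ω := rfl
      have e0 : stoppedValue (-W) (fun _ => ((0 : ℕ) : ℕ∞)) = fun ω => -W 0 ω := rfl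
      have h' : ∫ ω, -W 0 ω ∂μ ≤ ∫ ω, -stoppedValue W τ ω ∂μ := h
      rw [integral_neg, integral_neg] at h'
      linarith
    have hint : Integrable (stoppedValue W τ) μ := by
      have := (hW.neg.integrable_stoppedValue hτst hle).neg
      have e : -stoppedValue (-W) τ = stoppedValue W τ := by
        ext ω; simp [stoppedValue]
      rwa [e] at this
    refine le_trans ?_ h1
    refine le_trans ?_ (mul_meas_ge_le_integral_of_nonneg
      (Filter.Eventually.of_forall fun ω => hnonneg _ _) hint c)
    refine mul_le_mul_of_nonneg_left (measureReal_mono ?_) hc.le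
    rintro ω ⟨t, ht, hct⟩
    exact stoppedValue_hittingBtwn_mem (s := {y : ℝ | c ≤ y}) ⟨t, ⟨Nat.zero_le _, ht⟩, hct⟩
  have hset : {ω | ∃ t, c ≤ W t ω} = ⋃ n : ℕ, {ω | ∃ t ≤ n, c ≤ W t ω} := by
    ext ω
    simp only [Set.mem_ofPred_eq, Set.mem_iUnion]
    exact ⟨fun ⟨t, h⟩ => ⟨t, t, le_rfl, h⟩, fun ⟨_, t, _, h⟩ => ⟨t, h⟩⟩
  have hmono : Monotone fun n : ℕ => {ω | ∃ t ≤ n, c ≤ W t ω} :=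
    fun m n hmn ω ⟨t, ht, h⟩ => ⟨t, ht.trans hmn, h⟩
  have hlim := (ENNReal.tendsto_toReal (measure_ne_top μ _)).comp
    (tendsto_measure_iUnion_atTop (μ := μ) hmono)
  rw [hset]
  exact le_of_tendsto' (hlim.const_mul c) hfin

namespace LORIL

variable {X Y S Ω : Type*} [Fintype X] [Fintype Y] [Fintype S]
  [MeasurableSpace X] [MeasurableSingletonClass X]
  [MeasurableSpace Y] [MeasurableSingletonClass Y]
  [MeasurableSpace S] [MeasurableSingletonClass S]
  {mΩ : MeasurableSpace Ω} {μ : Measure Ω} [IsProbabilityMeasure μ] {ℱ : Filtration ℕ mΩ}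
  {P : Y → S → PMF X} {I : Interaction X Y S Ω}

/-- A product of per-round factors whose mean under the teacher is at most one is a
supermartingale. -/
theorem IsProtocol.supermartingale_prod (hI : IsProtocol μ ℱ P I) {r : Y → S → X → ℝ}
    (hr : ∀ y s a, 0 ≤ r y s a) (hr1 : ∀ y s, ∑ a, r y s a * (P y s a).toReal ≤ 1) :
    Supermartingale
      (fun t ω => ∏ ℓ ∈ Finset.Ico 1 t, r (I.y ℓ ω) (I.s ℓ ω) (I.x' ℓ ω)) ℱ μ := by
  set Z : ℕ → Ω → ℝ := fun t ω => ∏ ℓ ∈ Finset.Ico 1 t, r (I.y ℓ ω) (I.s ℓ ω) (I.x' ℓ ω) with hZ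
  have hmeas : ∀ t, Measurable[ℱ t] (Z t) := by
    intro t
    refine Finset.measurable_fun_prod _ fun ℓ hℓ => ?_
    obtain ⟨h1, h2⟩ := Finset.mem_Ico.1 hℓ
    have hy := (hI.measurable_y ℓ h1).mono (ℱ.mono h2.le) le_rfl
    have hs := (hI.measurable_s ℓ h1).mono (ℱ.mono h2.le) le_rfl
    have hx := (hI.measurable_x' ℓ h1).mono (ℱ.mono h2) le_rfl
    exact (Measurable.of_discrete (f := fun q : Y × S × X => r q.1 q.2.1 q.2.2)).comp
      (hy.prodMk (hs.prodMk hx))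
  obtain ⟨M, hM⟩ : ∃ M, ∀ y s a, r y s a ≤ M := by
    obtain ⟨M, hM⟩ := (Set.finite_range (fun q : Y × S × X => r q.1 q.2.1 q.2.2)).bddAbove
    exact ⟨M, fun y s a => hM ⟨(y, s, a), rfl⟩⟩
  have hZ0 : ∀ t ω, 0 ≤ Z t ω := fun t ω => Finset.prod_nonneg fun ℓ _ => hr _ _ _
  have hZM : ∀ t ω, ‖Z t ω‖ ≤ M ^ (Finset.Ico 1 t).card := by
    intro t ω
    rw [Real.norm_of_nonneg (hZ0 t ω), ← Finset.prod_const]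
    exact Finset.prod_le_prod (fun ℓ _ => hr _ _ _) fun ℓ _ => hM _ _ _
  have hint : ∀ t, Integrable (Z t) μ := fun t =>
    Integrable.of_bound ((hmeas t).mono (ℱ.le t) le_rfl).aestronglyMeasurable _
      (Filter.Eventually.of_forall (hZM t))
  refine supermartingale_nat (fun t => (hmeas t).stronglyMeasurable) hint fun t => ?_
  rcases Nat.eq_zero_or_pos t with rfl | ht
  · have : Z (0 + 1) = Z 0 := by ext ω; simp [hZ]
    rw [this, condExp_of_stronglyMeasurable (ℱ.le 0) (hmeas 0).stronglyMeasurable (hint 0)]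
  -- decompose the new factor according to the value of the hindsight instruction
  set G : X → Ω → ℝ := fun a ω => Z t ω * r (I.y t ω) (I.s t ω) a with hG
  set J : X → Ω → ℝ := fun a => (I.x' t ⁻¹' {a}).indicator (fun _ => (1 : ℝ)) with hJ
  have hdecomp : Z (t + 1) = ∑ a, G a * J a := by
    ext ω
    simp only [hZ, hG, hJ, Finset.sum_apply, Pi.mul_apply, Finset.prod_Ico_succ_top ht]
    rw [Finset.sum_eq_single (I.x' t ω)]
    · simp
    · intro a _ ha
      rw [Set.indicator_of_notMem (by simpa using Ne.symm ha), mul_zero]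
    · simp
  have hGm : ∀ a, Measurable[ℱ t] (G a) := fun a =>
    (hmeas t).mul ((Measurable.of_discrete (f := fun q : Y × S => r q.1 q.2 a)).comp
      ((hI.measurable_y t ht).prodMk (hI.measurable_s t ht)))
  have hJm : ∀ a, Measurable (J a) := fun a =>
    measurable_const.indicator
      (((hI.measurable_x' t ht).mono (ℱ.le _) le_rfl) (measurableSet_singleton a))
  have hJi : ∀ a, Integrable (J a) μ := fun a =>
    Integrable.of_bound (hJm a).aestronglyMeasurable 1 (Filter.Eventually.of_forall fun ω => by
      by_cases h : ω ∈ I.x' t ⁻¹' {a} <;> simp [hJ, h])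
  have hGJi : ∀ a, Integrable (G a * J a) μ := by
    intro a
    refine (hJi a).bdd_mul (c := M ^ (Finset.Ico 1 t).card * |M|)
      ((hGm a).mono (ℱ.le t) le_rfl).aestronglyMeasurable
      (Filter.Eventually.of_forall fun ω => ?_)
    rw [hG, norm_mul]
    refine mul_le_mul (hZM t ω) ?_ (norm_nonneg _) ((norm_nonneg _).trans (hZM t ω))
    rw [Real.norm_of_nonneg (hr _ _ _)]
    exact (hM _ _ _).trans (le_abs_self M)
  have hcond : ∀ a, μ[G a * J a | ℱ t] =ᵐ[μ]
      fun ω => G a ω * (P (I.y t ω) (I.s t ω) a).toReal := fun a =>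
    (condExp_mul_of_stronglyMeasurable_left (hGm a).stronglyMeasurable (hGJi a) (hJi a)).trans
      ((hI.teacher t ht a).mono fun ω h => by
        rw [Pi.mul_apply]; exact congrArg (G a ω * ·) h)
  rw [hdecomp]
  filter_upwards [condExp_finsetSum (s := Finset.univ) (fun a _ => hGJi a) (ℱ t),
    ae_all_iff.2 hcond] with ω h1 h2
  rw [h1, Finset.sum_apply, Finset.sum_congr rfl fun a _ => h2 a]
  simp only [hG, mul_assoc]
  rw [← Finset.mul_sum]
  exact mul_le_of_le_one_right (hZ0 t ω) (hr1 _ _)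

/-- Ville's inequality for a product of per-round factors with conditional mean at most one. -/
theorem IsProtocol.mul_measureReal_exists_prod_ge_le (hI : IsProtocol μ ℱ P I)
    {r : Y → S → X → ℝ} (hr : ∀ y s a, 0 ≤ r y s a)
    (hr1 : ∀ y s, ∑ a, r y s a * (P y s a).toReal ≤ 1) (c : ℝ) :
    c * μ.real {ω | ∃ t, c ≤ ∏ ℓ ∈ Finset.Ico 1 t, r (I.y ℓ ω) (I.s ℓ ω) (I.x' ℓ ω)} ≤ 1 := by
  refine ((hI.supermartingale_prod hr hr1).mul_measureReal_exists_ge_le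
    (fun t ω => Finset.prod_nonneg fun ℓ _ => hr _ _ _) c).trans ?_
  simp

end LORIL

/-! ### Hellinger affinity and maximum likelihood -/

namespace LORIL

/-- The Hellinger affinity (Bhattacharyya coefficient) `∑ₓ √(p(x) q(x))`. -/
noncomputable def affinity {X : Type*} [Fintype X] (p q : X → ℝ) : ℝ := ∑ x, √(p x * q x)

/-- Two probability vectors differ at each point by at most a multiple of their Hellinger
distance `√(2 (1 - affinity p q))`. -/
theorem sq_sub_le_affinity {X : Type*} [Fintype X] {p q : X → ℝ} (hp : ∀ x, 0 ≤ p x)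
    (hq : ∀ x, 0 ≤ q x) (hp1 : ∑ x, p x = 1) (hq1 : ∑ x, q x = 1) (x : X) :
    (p x - q x) ^ 2 ≤ 8 * (1 - affinity p q) := by
  have hle1 : ∀ {r : X → ℝ}, (∀ x, 0 ≤ r x) → ∑ x, r x = 1 → √(r x) ≤ 1 := fun {r} hr hr1 =>
    Real.sqrt_le_one.2 <| hr1 ▸ Finset.single_le_sum (fun x _ => hr x) (Finset.mem_univ x)
  have hsum : ∑ x, (√(p x) - √(q x)) ^ 2 = 2 * (1 - affinity p q) := by
    have h : ∀ x, (√(p x) - √(q x)) ^ 2 = p x + q x - 2 * √(p x * q x) := fun x => by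
      rw [Real.sqrt_mul (hp x), sub_sq, Real.sq_sqrt (hp x), Real.sq_sqrt (hq x)]; ring
    simp only [h, Finset.sum_sub_distrib, Finset.sum_add_distrib, hp1, hq1, ← Finset.mul_sum,
      affinity]
    ring
  have hx : (√(p x) - √(q x)) ^ 2 ≤ 2 * (1 - affinity p q) := hsum ▸
    Finset.single_le_sum (f := fun x => (√(p x) - √(q x)) ^ 2) (fun x _ => sq_nonneg _)
      (Finset.mem_univ x)
  have hfac : (p x - q x) ^ 2 = (√(p x) - √(q x)) ^ 2 * (√(p x) + √(q x)) ^ 2 := by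
    rw [← mul_pow, mul_comm, ← sq_sub_sq, Real.sq_sqrt (hp x), Real.sq_sqrt (hq x)]
  have h4 : (√(p x) + √(q x)) ^ 2 ≤ 4 := by
    nlinarith [hle1 hp hp1, hle1 hq hq1, Real.sqrt_nonneg (p x), Real.sqrt_nonneg (q x)]
  rw [hfac]
  nlinarith [sq_nonneg (√(p x) - √(q x)), sq_nonneg (√(p x) + √(q x))]

/-- The root of the likelihood ratio `p / q`, normalized to have mean at most one under `q`
(through `z exp (1 - z) ≤ 1` for the affinity `z`). Where `q` vanishes its value is zero. -/
noncomputable def rootRatio {X : Type*} [Fintype X] (p q : X → ℝ) (x : X) : ℝ :=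
  √(p x / q x) * Real.exp (1 - affinity p q)

theorem rootRatio_nonneg {X : Type*} [Fintype X] (p q : X → ℝ) (x : X) : 0 ≤ rootRatio p q x := by
  unfold rootRatio; positivity

theorem sum_rootRatio_mul_le_one {X : Type*} [Fintype X] {p q : X → ℝ} (hp : ∀ x, 0 ≤ p x)
    (hq : ∀ x, 0 ≤ q x) : ∑ x, rootRatio p q x * q x ≤ 1 := by
  have hterm : ∀ x, rootRatio p q x * q x ≤ √(p x * q x) * Real.exp (1 - affinity p q) := by
    intro x
    rw [rootRatio, mul_right_comm]
    refine mul_le_mul_of_nonneg_right ?_ (Real.exp_nonneg _)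
    rcases (hq x).eq_or_lt with h | h
    · simp [← h]
    · refine Real.le_sqrt_of_sq_le ?_
      rw [mul_pow, Real.sq_sqrt (div_nonneg (hp x) h.le), div_mul_eq_mul_div, sq,
        ← mul_assoc, mul_div_cancel_right₀ _ h.ne']
  refine (Finset.sum_le_sum fun x _ => hterm x).trans ?_
  rw [← Finset.sum_mul]
  change affinity p q * Real.exp (1 - affinity p q) ≤ 1
  have h1 : affinity p q ≤ Real.exp (affinity p q - 1) := by
    linarith [Real.add_one_le_exp (affinity p q - 1)]
  calc _ ≤ Real.exp (affinity p q - 1) * Real.exp (1 - affinity p q) := by gcongr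
    _ = 1 := by rw [← Real.exp_add]; simp

/-- A sum of extended logarithms is the extended logarithm of the product. -/
theorem sum_log_ofReal {ι : Type*} (s : Finset ι) {a : ι → ℝ} (ha : ∀ i, 0 ≤ a i) :
    ∑ i ∈ s, ENNReal.log (ENNReal.ofReal (a i)) =
      ENNReal.log (ENNReal.ofReal (∏ i ∈ s, a i)) := by
  classical
  induction s using Finset.induction_on with
  | empty => simp
  | insert i s hi ih =>
    rw [Finset.sum_insert hi, Finset.prod_insert hi, ih, ENNReal.ofReal_mul (ha i),
      ENNReal.log_mul_add]

/-- If the product of the likelihoods `p` is at least that of the positive likelihoods `q`, the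
product of the normalized ratios `rootRatio p q` is at least `exp ∑ (1 - affinity p q)`. -/
theorem exp_sum_le_prod_rootRatio {X ι : Type*} [Fintype X] (s : Finset ι) {p q : ι → X → ℝ}
    (x : ι → X) (hp : ∀ i x, 0 ≤ p i x) (hq : ∀ i ∈ s, 0 < q i (x i))
    (h : ∏ i ∈ s, q i (x i) ≤ ∏ i ∈ s, p i (x i)) :
    Real.exp (∑ i ∈ s, (1 - affinity (p i) (q i))) ≤ ∏ i ∈ s, rootRatio (p i) (q i) (x i) := by
  simp only [rootRatio]
  rw [Finset.prod_mul_distrib, ← Real.exp_sum]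
  refine le_mul_of_one_le_left (Real.exp_nonneg _) ?_
  have hsq : (∏ i ∈ s, √(p i (x i) / q i (x i))) ^ 2 =
      (∏ i ∈ s, p i (x i)) / ∏ i ∈ s, q i (x i) := by
    rw [← Finset.prod_pow, ← Finset.prod_div_distrib]
    exact Finset.prod_congr rfl fun i hi => Real.sq_sqrt (div_nonneg (hp _ _) (hq i hi).le)
  refine (one_le_sq_iff₀ (Finset.prod_nonneg fun i _ => Real.sqrt_nonneg _)).1 ?_
  rw [hsq, one_le_div (Finset.prod_pos hq)]
  exact h

section Confidence

variable {X Y S Ω : Type*} [Fintype X] [Fintype Y] [Fintype S]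
  [MeasurableSpace X] [MeasurableSingletonClass X]
  [MeasurableSpace Y] [MeasurableSingletonClass Y]
  [MeasurableSpace S] [MeasurableSingletonClass S]
  {mΩ : MeasurableSpace Ω} {μ : Measure Ω} [IsProbabilityMeasure μ] {ℱ : Filtration ℕ mΩ}
  {P : Y → S → PMF X} {I : Interaction X Y S Ω} {d : ℕ}
  {F : Finset (X → EuclideanSpace ℝ (Fin d))} {g : Y → S → EuclideanSpace ℝ (Fin d)}

/-- The event that, simultaneously in all rounds and at every instruction, every `f ∈ F` at least as
likely as `fstar` has a small cumulative squared prediction error on the past features. -/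
def ConfidenceEvent (I : Interaction X Y S Ω) (F : Finset (X → EuclideanSpace ℝ (Fin d)))
    (g : Y → S → EuclideanSpace ℝ (Fin d)) (fstar : X → EuclideanSpace ℝ (Fin d)) (δ : ℝ) :
    Set Ω :=
  {ω | ∀ t, ∀ f ∈ F, I.logLikelihood g t ω fstar ≤ I.logLikelihood g t ω f →
    ∀ x : X, ∑ ℓ ∈ Finset.Ico 1 t, (inner ℝ (f x - fstar x) (g (I.y ℓ ω) (I.s ℓ ω))) ^ 2 ≤
      8 * Real.log (F.card / δ)}

/-- The maximum likelihood confidence sets hold at all times with high probability. The bad event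
is covered by the events that one of the normalized likelihood ratios ever exceeds `|F| / δ`, and
that a hindsight instruction of probability zero ever occurs. -/
theorem one_sub_le_measureReal_confidenceEvent (hI : IsProtocol μ ℱ P I)
    {fstar : X → EuclideanSpace ℝ (Fin d)} (hfstar : fstar ∈ F)
    (hP : ∀ s x y, (P y s x).toReal = inner ℝ (fstar x) (g y s))
    (hF : ∀ f ∈ F, ∀ y s, (∀ x, 0 ≤ (inner ℝ (f x) (g y s) : ℝ)) ∧
      ∑ x, (inner ℝ (f x) (g y s) : ℝ) = 1)
    {δ : ℝ} (hδ : 0 < δ) (hδ1 : δ < 1) :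
    1 - 2 * δ ≤ μ.real (ConfidenceEvent I F g fstar δ) := by
  classical
  set r : (X → EuclideanSpace ℝ (Fin d)) → Y → S → X → ℝ := fun f y s =>
    rootRatio (fun x => inner ℝ (f x) (g y s)) (fun x => inner ℝ (fstar x) (g y s)) with hr
  -- a factor which exceeds one only at instructions of probability zero
  set r₀ : Y → S → X → ℝ := fun y s a => if (P y s a).toReal = 0 then 1 / δ else 1 with hr₀
  set Bad : (Y → S → X → ℝ) → ℝ → Set Ω := fun r c =>
    {ω | ∃ t, c ≤ ∏ ℓ ∈ Finset.Ico 1 t, r (I.y ℓ ω) (I.s ℓ ω) (I.x' ℓ ω)} with hBad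
  have hN : (0 : ℝ) < F.card := mod_cast Finset.card_pos.2 ⟨fstar, hfstar⟩
  have hδ' : 1 ≤ 1 / δ := (one_le_div hδ).2 hδ1.le
  have hr₀1 : ∀ y s a, 1 ≤ r₀ y s a := fun y s a => by
    simp only [hr₀]; split_ifs <;> linarith
  have hbad₀ : μ.real (Bad r₀ (1 / δ)) ≤ δ := by
    have h := hI.mul_measureReal_exists_prod_ge_le (r := r₀)
      (fun y s a => zero_le_one.trans (hr₀1 y s a)) (fun y s => by
        have : ∀ a, r₀ y s a * (P y s a).toReal = inner ℝ (fstar a) (g y s) := fun a => by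
          rw [← hP]; simp only [hr₀]; split_ifs with h <;> simp [h]
        simp only [this, (hF fstar hfstar y s).2, le_refl]) (1 / δ)
    rwa [one_div, inv_mul_le_iff₀ hδ, mul_one, ← one_div] at h
  have hbad : ∀ f ∈ F, μ.real (Bad (r f) (F.card / δ)) ≤ δ / F.card := fun f hf => by
    have h := hI.mul_measureReal_exists_prod_ge_le (r := r f)
      (fun y s a => rootRatio_nonneg _ _ _) (fun y s => by
        simp only [hP]
        exact sum_rootRatio_mul_le_one (hF f hf y s).1 (hF fstar hfstar y s).1) (F.card / δ)
    rw [le_div_iff₀ hN]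
    rw [div_mul_eq_mul_div, div_le_iff₀ hδ] at h
    linarith
  have hunion : μ.real (Bad r₀ (1 / δ) ∪ ⋃ f ∈ F, Bad (r f) (F.card / δ)) ≤ 2 * δ := by
    refine (measureReal_union_le _ _).trans ?_
    have h := (measureReal_biUnion_finset_le F fun f => Bad (r f) (F.card / δ)).trans
      (Finset.sum_le_sum hbad)
    rw [Finset.sum_const, nsmul_eq_mul, mul_div_cancel₀ _ hN.ne'] at h
    linarith
  have hcover : Set.univ ⊆ (Bad r₀ (1 / δ) ∪ ⋃ f ∈ F, Bad (r f) (F.card / δ)) ∪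
      ConfidenceEvent I F g fstar δ := by
    intro ω _
    by_contra hω
    simp only [Set.mem_union, Set.mem_iUnion, not_or, not_exists, hBad, Set.mem_ofPred_eq,
      not_le] at hω
    obtain ⟨⟨h₀, hf⟩, hE⟩ := hω
    refine hE fun t f hfF hlik x => ?_
    have hpos : ∀ ℓ ∈ Finset.Ico 1 t,
        (0 : ℝ) < inner ℝ (fstar (I.x' ℓ ω)) (g (I.y ℓ ω) (I.s ℓ ω)) := by
      intro ℓ hℓ
      refine lt_of_le_of_ne ((hF fstar hfstar _ _).1 _) fun h0 => (h₀ t).not_ge ?_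
      refine le_trans (le_of_eq ?_) (Multiset.mem_le_prod_of_one_le
        (f := fun k => r₀ (I.y k ω) (I.s k ω) (I.x' k ω)) (fun k => hr₀1 _ _ _) hℓ)
      simp [hr₀, hP, ← h0]
    have hprod : ∏ ℓ ∈ Finset.Ico 1 t,
          (inner ℝ (fstar (I.x' ℓ ω)) (g (I.y ℓ ω) (I.s ℓ ω)) : ℝ) ≤
        ∏ ℓ ∈ Finset.Ico 1 t, (inner ℝ (f (I.x' ℓ ω)) (g (I.y ℓ ω) (I.s ℓ ω)) : ℝ) := by
      rw [Interaction.logLikelihood, Interaction.logLikelihood,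
        sum_log_ofReal _ fun ℓ => (hF fstar hfstar _ _).1 _,
        sum_log_ofReal _ fun ℓ => (hF f hfF _ _).1 _, ENNReal.log_le_log_iff] at hlik
      exact (ENNReal.ofReal_le_ofReal_iff
        (Finset.prod_nonneg fun ℓ _ => (hF f hfF _ _).1 _)).1 hlik
    have hexp := (exp_sum_le_prod_rootRatio (Finset.Ico 1 t)
      (p := fun ℓ x => inner ℝ (f x) (g (I.y ℓ ω) (I.s ℓ ω)))
      (q := fun ℓ x => inner ℝ (fstar x) (g (I.y ℓ ω) (I.s ℓ ω))) (fun ℓ => I.x' ℓ ω)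
      (fun ℓ => (hF f hfF _ _).1) hpos hprod).trans (hf f hfF t).le
    rw [← Real.le_log_iff_exp_le (by positivity)] at hexp
    refine le_trans ?_ (mul_le_mul_of_nonneg_left hexp (by norm_num))
    rw [Finset.mul_sum]
    refine Finset.sum_le_sum fun ℓ _ => ?_
    rw [inner_sub_left]
    exact sq_sub_le_affinity (hF f hfF _ _).1 (hF fstar hfstar _ _).1 (hF f hfF _ _).2
      (hF fstar hfstar _ _).2 x
  have h := (measureReal_mono (μ := μ) hcover).trans (measureReal_union_le _ _)
  rw [probReal_univ] at h
  linarith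

end Confidence

end LORIL

/-! ### Weighted norms and the elliptic potential -/

namespace LORIL

open Matrix

variable {d : ℕ}

/-- Cauchy–Schwarz for the dual pair of norms `‖·‖_A` and `‖·‖_{A⁻¹}`. -/
theorem abs_inner_le_matNorm_mul_matNorm_inv {A : Matrix (Fin d) (Fin d) ℝ} (hA : A.PosDef)
    (v w : EuclideanSpace ℝ (Fin d)) :
    |inner ℝ v w| ≤ matNorm A v * matNorm A⁻¹ w := by
  have hu : IsUnit A.det := hA.det_pos.ne'.isUnit
  have hsymm : Aᵀ = A := by simpa using hA.isHermitian.eq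
  set v' := v.ofLp
  set u := A⁻¹ *ᵥ w.ofLp with hu'
  have hAu : A *ᵥ u = w.ofLp := by
    rw [hu', mulVec_mulVec, mul_nonsing_inv _ hu, one_mulVec]
  have hinner : inner ℝ v w = v' ⬝ᵥ w.ofLp := by
    rw [EuclideanSpace.inner_eq_star_dotProduct, dotProduct_comm]; simp [v']
  have hq : ∀ z : Fin d → ℝ, 0 ≤ z ⬝ᵥ A *ᵥ z := fun z => by
    simpa using hA.posSemidef.dotProduct_mulVec_nonneg z
  have hcomm : u ⬝ᵥ A *ᵥ v' = v' ⬝ᵥ w.ofLp := by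
    rw [← hAu, dotProduct_mulVec, ← mulVec_transpose, hsymm, dotProduct_comm]
  have huu : u ⬝ᵥ A *ᵥ u = w.ofLp ⬝ᵥ A⁻¹ *ᵥ w.ofLp := by
    rw [hAu, dotProduct_comm, hu']
  have hdisc := discrim_le_zero (a := w.ofLp ⬝ᵥ A⁻¹ *ᵥ w.ofLp) (b := 2 * (v' ⬝ᵥ w.ofLp))
    (c := v' ⬝ᵥ A *ᵥ v') fun t => by
      have h := hq (v' + t • u)
      rw [mulVec_add, mulVec_smul, dotProduct_add, add_dotProduct, add_dotProduct,
        dotProduct_smul, dotProduct_smul, smul_dotProduct, smul_dotProduct, hcomm, huu, hAu] at h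
      simp only [smul_eq_mul] at h
      nlinarith [h]
  rw [hinner, matNorm, matNorm, ← Real.sqrt_mul (hq _)]
  refine Real.abs_le_sqrt ?_
  rw [discrim] at hdisc
  nlinarith [hdisc]

/-- Inversion reverses the Loewner order, expressed through the associated norms. -/
theorem matNorm_inv_le_of_le {A A' : Matrix (Fin d) (Fin d) ℝ} (hA : A.PosDef) (hA' : A'.PosDef)
    (h : ∀ v : Fin d → ℝ, v ⬝ᵥ A *ᵥ v ≤ v ⬝ᵥ A' *ᵥ v) (w : EuclideanSpace ℝ (Fin d)) :
    matNorm A'⁻¹ w ≤ matNorm A⁻¹ w := by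
  set u : EuclideanSpace ℝ (Fin d) := WithLp.toLp 2 (A'⁻¹ *ᵥ w.ofLp) with hu
  have hAu : A' *ᵥ u.ofLp = w.ofLp := by
    rw [hu, mulVec_mulVec, mul_nonsing_inv _ hA'.det_pos.ne'.isUnit, one_mulVec]
  have hnonneg : 0 ≤ w.ofLp ⬝ᵥ A'⁻¹ *ᵥ w.ofLp := by
    simpa using hA'.inv.posSemidef.dotProduct_mulVec_nonneg w.ofLp
  have huw : matNorm A' u = matNorm A'⁻¹ w := by
    rw [matNorm, matNorm, hAu, dotProduct_comm]
  have hsq : inner ℝ u w = matNorm A'⁻¹ w ^ 2 := by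
    rw [matNorm, Real.sq_sqrt hnonneg, EuclideanSpace.inner_eq_star_dotProduct]
    simp [hu]
  have hle : matNorm A u ≤ matNorm A'⁻¹ w := by
    rw [← huw]; exact Real.sqrt_le_sqrt (h _)
  have hcs := (le_abs_self _).trans (abs_inner_le_matNorm_mul_matNorm_inv hA u w)
  rw [hsq] at hcs
  have h0 : 0 ≤ matNorm A'⁻¹ w := Real.sqrt_nonneg _
  have h1 : 0 ≤ matNorm A⁻¹ w := Real.sqrt_nonneg _
  rcases h0.eq_or_lt with h2 | h2
  · rw [← h2]; exact h1
  · nlinarith [mul_le_mul_of_nonneg_right hle h1]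

/-- The covariance matrix `c I + ∑_{ℓ < t} v_ℓ v_ℓᵀ` of vectors `v_1, …, v_{t-1}`. -/
noncomputable def covariance (c : ℝ) (v : ℕ → EuclideanSpace ℝ (Fin d)) (t : ℕ) :
    Matrix (Fin d) (Fin d) ℝ :=
  c • (1 : Matrix (Fin d) (Fin d) ℝ) + ∑ ℓ ∈ Finset.Ico 1 t, vecMulVec (v ℓ).ofLp (v ℓ).ofLp

theorem covariance_posDef {c : ℝ} (hc : 0 < c) (v : ℕ → EuclideanSpace ℝ (Fin d)) (t : ℕ) :
    (covariance c v t).PosDef := by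
  refine (PosDef.one.smul hc).add_posSemidef (posSemidef_sum _ fun ℓ _ => ?_)
  simpa using posSemidef_vecMulVec_self_star (v ℓ).ofLp

theorem dotProduct_covariance_mulVec (c : ℝ) (v : ℕ → EuclideanSpace ℝ (Fin d)) (t : ℕ)
    (u : EuclideanSpace ℝ (Fin d)) :
    u.ofLp ⬝ᵥ covariance c v t *ᵥ u.ofLp =
      c * ‖u‖ ^ 2 + ∑ ℓ ∈ Finset.Ico 1 t, (inner ℝ u (v ℓ)) ^ 2 := by
  rw [covariance, add_mulVec, dotProduct_add, smul_mulVec, one_mulVec, dotProduct_smul,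
    sum_mulVec, dotProduct_sum]
  congr 1
  · rw [← real_inner_self_eq_norm_sq, EuclideanSpace.inner_eq_star_dotProduct]
    simp
  · refine Finset.sum_congr rfl fun ℓ _ => ?_
    rw [vecMulVec_mulVec, EuclideanSpace.inner_eq_star_dotProduct]
    simp [dotProduct_comm, sq]

theorem covariance_quadForm_mono {c c' : ℝ} (hc : c ≤ c') (v : ℕ → EuclideanSpace ℝ (Fin d))
    (t : ℕ) (u : Fin d → ℝ) :
    u ⬝ᵥ covariance c v t *ᵥ u ≤ u ⬝ᵥ covariance c' v t *ᵥ u := by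
  have h := dotProduct_covariance_mulVec c v t (WithLp.toLp 2 u)
  have h' := dotProduct_covariance_mulVec c' v t (WithLp.toLp 2 u)
  simp only at h h'
  rw [h, h']
  gcongr

/-- Adding a vector multiplies the determinant by `1 + ‖v_t‖²_{V_t⁻¹}`. -/
theorem det_covariance_succ {c : ℝ} (hc : 0 < c) (v : ℕ → EuclideanSpace ℝ (Fin d)) {t : ℕ}
    (ht : 1 ≤ t) :
    (covariance c v (t + 1)).det =
      (covariance c v t).det * (1 + matNorm (covariance c v t)⁻¹ (v t) ^ 2) := by
  have hpos := covariance_posDef hc v t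
  have hsucc : covariance c v (t + 1) = covariance c v t +
      replicateCol Unit (v t).ofLp * replicateRow Unit (v t).ofLp := by
    rw [covariance, covariance, Finset.sum_Ico_succ_top ht, vecMulVec_eq Unit, add_assoc]
  rw [hsucc, det_add_replicateCol_mul_replicateRow hpos.det_pos.ne'.isUnit, matNorm,
    Real.sq_sqrt (by simpa using hpos.inv.posSemidef.dotProduct_mulVec_nonneg (v t).ofLp)]
  congr 1
  rw [det_unique, Matrix.add_apply, Matrix.one_apply_eq, Matrix.mul_assoc, ← replicateCol_mulVec]
  simp [mul_apply, dotProduct]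

/-- The concavity of the logarithm bounds the determinant through the trace. -/
theorem log_det_covariance_le {c B : ℝ} (hc : 0 < c) (hd : 0 < d)
    (v : ℕ → EuclideanSpace ℝ (Fin d)) (hv : ∀ ℓ, ‖v ℓ‖ ≤ B) (T : ℕ) :
    Real.log (covariance c v (T + 1)).det ≤ d * Real.log (c + T * B ^ 2) := by
  have hpos := covariance_posDef hc v (T + 1)
  have hd1 : (1 : ℝ) ≤ d := mod_cast hd
  set m : ℝ := c + T * B ^ 2 with hm
  have hm0 : 0 < m := by positivity
  have htr : (covariance c v (T + 1)).trace ≤ d * m := by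
    have hsum : ∑ ℓ ∈ Finset.Ico 1 (T + 1), (v ℓ).ofLp ⬝ᵥ (v ℓ).ofLp ≤ T * B ^ 2 := by
      refine (Finset.sum_le_card_nsmul _ _ (B ^ 2) fun ℓ _ => ?_).trans (by simp)
      have : (v ℓ).ofLp ⬝ᵥ (v ℓ).ofLp = ‖v ℓ‖ ^ 2 := by
        rw [← real_inner_self_eq_norm_sq, EuclideanSpace.inner_eq_star_dotProduct]; simp
      rw [this]
      exact pow_le_pow_left₀ (norm_nonneg _) (hv ℓ) 2
    rw [covariance, trace_add, trace_smul, trace_one, trace_sum]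
    simp only [trace_vecMulVec, Fintype.card_fin, smul_eq_mul]
    have : 0 ≤ T * B ^ 2 := by positivity
    nlinarith
  have hev := hpos.eigenvalues_pos
  rw [hpos.isHermitian.det_eq_prod_eigenvalues]
  simp only [RCLike.ofReal_real_eq_id, id_eq]
  rw [Real.log_prod fun i _ => (hev i).ne']
  -- tangent line of the logarithm at `m`, which dominates the mean eigenvalue
  have htangent : ∀ i, Real.log (hpos.isHermitian.eigenvalues i) ≤
      hpos.isHermitian.eigenvalues i / m - 1 + Real.log m := fun i => by
    have := Real.log_le_sub_one_of_pos (div_pos (hev i) hm0)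
    rw [Real.log_div (hev i).ne' hm0.ne'] at this
    linarith
  refine (Finset.sum_le_sum fun i _ => htangent i).trans ?_
  have htrace : (covariance c v (T + 1)).trace = ∑ i, hpos.isHermitian.eigenvalues i := by
    simpa using hpos.isHermitian.trace_eq_sum_eigenvalues
  rw [Finset.sum_add_distrib, Finset.sum_sub_distrib, ← Finset.sum_div, ← htrace]
  simp only [Finset.sum_const, Finset.card_univ, Fintype.card_fin, nsmul_eq_mul, mul_one]
  have : (covariance c v (T + 1)).trace / m ≤ d := by rwa [div_le_iff₀ hm0]
  linarith

/-- **Elliptic potential lemma**, with a fixed regularizer `c`. -/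
theorem sum_min_one_sq_matNorm_le {c B : ℝ} (hc : 0 < c) (hd : 0 < d)
    (v : ℕ → EuclideanSpace ℝ (Fin d)) (hv : ∀ ℓ, ‖v ℓ‖ ≤ B) (T : ℕ) :
    ∑ t ∈ Finset.Icc 1 T, min 1 (matNorm (covariance c v t)⁻¹ (v t)) ^ 2 ≤
      2 * d * Real.log (1 + T * B ^ 2 / c) := by
  have hdet : ∀ T : ℕ, ∑ t ∈ Finset.Icc 1 T,
      Real.log (1 + matNorm (covariance c v t)⁻¹ (v t) ^ 2) =
        Real.log (covariance c v (T + 1)).det - d * Real.log c := by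
    intro T
    induction T with
    | zero => simp [covariance]
    | succ T ih =>
      rw [Finset.sum_Icc_succ_top (by omega), ih, det_covariance_succ hc v (t := T + 1) (by omega),
        Real.log_mul (covariance_posDef hc v _).det_pos.ne' (by positivity)]
      ring
  have hmin : ∀ w : ℝ, 0 ≤ w → min 1 w ^ 2 ≤ 2 * Real.log (1 + w ^ 2) := by
    intro w hw
    have hx : 0 ≤ min 1 w ^ 2 := sq_nonneg _
    have hx1 : min 1 w ^ 2 ≤ 1 := pow_le_one₀ (le_min zero_le_one hw) (min_le_left _ _)
    have hxw : min 1 w ^ 2 ≤ w ^ 2 :=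
      pow_le_pow_left₀ (le_min zero_le_one hw) (min_le_right _ _) 2
    have hlog := Real.log_le_log (by positivity) (add_le_add_right hxw 1)
    -- `log (1 + x) ≥ x / (1 + x) ≥ x / 2` for `x ≤ 1`
    have h1 := Real.one_sub_inv_le_log_of_pos (x := 1 + min 1 w ^ 2) (by positivity)
    have h2 : min 1 w ^ 2 / 2 ≤ 1 - (1 + min 1 w ^ 2)⁻¹ := by
      have : 1 - (1 + min 1 w ^ 2)⁻¹ = min 1 w ^ 2 / (1 + min 1 w ^ 2) := by field_simp; ring
      rw [this]
      exact div_le_div_of_nonneg_left hx (by positivity) (by linarith)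
    linarith
  calc _ ≤ ∑ t ∈ Finset.Icc 1 T, 2 * Real.log (1 + matNorm (covariance c v t)⁻¹ (v t) ^ 2) :=
        Finset.sum_le_sum fun t _ => hmin _ (Real.sqrt_nonneg _)
    _ = 2 * (Real.log (covariance c v (T + 1)).det - d * Real.log c) := by
        rw [← Finset.mul_sum, hdet]
    _ ≤ 2 * (d * Real.log (c + T * B ^ 2) - d * Real.log c) := by
        gcongr; exact log_det_covariance_le hc hd v hv T
    _ = 2 * d * Real.log (1 + T * B ^ 2 / c) := by
        rw [← mul_sub, ← Real.log_div (by positivity) hc.ne', add_div, div_self hc.ne']; ring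

end LORIL

/-! ### Regret of optimism -/

namespace LORIL

variable {X Y S Ω : Type*} {d : ℕ}

theorem lam_pos {t : ℕ} (ht : 1 ≤ t) : 0 < lam t := by
  have : (0 : ℝ) < t := mod_cast ht
  exact one_div_pos.2 this

theorem lam_le_one {t : ℕ} (ht : 1 ≤ t) : lam t ≤ 1 :=
  div_le_one_of_le₀ (by exact_mod_cast ht) (Nat.cast_nonneg t)

theorem lam_anti {t T : ℕ} (ht : 1 ≤ t) (hT : t ≤ T) : lam T ≤ lam t :=
  one_div_le_one_div_of_le (by exact_mod_cast ht) (by exact_mod_cast hT)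

/-- On the confidence event the bonus dominates the error of the estimated model. -/
theorem abs_inner_sub_le_bonus {I : Interaction X Y S Ω}
    {F : Finset (X → EuclideanSpace ℝ (Fin d))} {g : Y → S → EuclideanSpace ℝ (Fin d)}
    {fstar f : X → EuclideanSpace ℝ (Fin d)} {C' B δ : ℝ} {t : ℕ} {ω : Ω}
    (hC : 3 ≤ C') (hB : 0 < B) (hδ : 0 < δ) (ht : 1 ≤ t)
    (hbd : BoundedFeatures B F g) (hfstar : fstar ∈ F) (hf : f ∈ F)
    (hω : ω ∈ ConfidenceEvent I F g fstar δ)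
    (hlik : I.logLikelihood g t ω fstar ≤ I.logLikelihood g t ω f) (x : X) (y : Y) (s : S) :
    |inner ℝ (f x - fstar x) (g y s)| ≤ I.bonus g C' B δ F.card t ω y s := by
  have hN : (0 : ℝ) < F.card := mod_cast Finset.card_pos.2 ⟨f, hf⟩
  have ht' : (1 : ℝ) ≤ t := mod_cast ht
  set u := f x - fstar x with hu
  have hu2 : ‖u‖ ≤ 2 * B := by
    linarith [norm_sub_le (f x) (fstar x), hbd.1 f hf x, hbd.1 fstar hfstar x]
  have hsum := hω t f hf hlik x
  have hlog : Real.log (F.card / δ) ≤ Real.log (t * F.card / δ) :=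
    Real.log_le_log (by positivity)
      (div_le_div_of_nonneg_right (le_mul_of_one_le_left hN.le ht') hδ.le)
  set L := Real.log (t * F.card / δ) with hL
  have hL0 : 0 ≤ L := by
    have h0 : 0 ≤ 8 * Real.log (F.card / δ) := (Finset.sum_nonneg fun ℓ _ => sq_nonneg _).trans hsum
    linarith
  have hlam := lam_pos ht
  have hpos : (I.sigmaHat g t ω).PosDef :=
    covariance_posDef hlam (fun ℓ => g (I.y ℓ ω) (I.s ℓ ω)) t
  have hnorm : matNorm (I.sigmaHat g t ω) u ≤ C' * (√L + √(lam t) * B) := by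
    refine Real.sqrt_le_iff.2 ⟨by positivity, ?_⟩
    have hquad := dotProduct_covariance_mulVec (lam t) (fun ℓ => g (I.y ℓ ω) (I.s ℓ ω)) t u
    change u.ofLp ⬝ᵥ (I.sigmaHat g t ω).mulVec u.ofLp = _ at hquad
    rw [hquad]
    have h1 : lam t * ‖u‖ ^ 2 ≤ lam t * (2 * B) ^ 2 := by gcongr
    have h2 : (3 * (√L + √(lam t) * B)) ^ 2 ≤ (C' * (√L + √(lam t) * B)) ^ 2 := by gcongr
    have h3 := Real.sq_sqrt hL0
    have h4 := Real.sq_sqrt hlam.le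
    have h5 : 0 ≤ √L * (√(lam t) * B) := by positivity
    have h6 : 0 ≤ lam t * B ^ 2 := by positivity
    have h7 : (3 * (√L + √(lam t) * B)) ^ 2 =
        9 * √L ^ 2 + 9 * (√(lam t) ^ 2 * B ^ 2) + 18 * (√L * (√(lam t) * B)) := by ring
    rw [h3, h4] at h7
    linarith
  refine (abs_inner_le_matNorm_mul_matNorm_inv hpos u (g y s)).trans ?_
  exact mul_le_mul_of_nonneg_right hnorm (Real.sqrt_nonneg _)

/-- Summation of per-round regrets `ρ t ≤ min {1, B², α_t w_t}` against an elliptic potential. From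
the second round on, `α_t` is at least one, so that `ρ t` is bounded by `α_t min {1, w_t}`; the
first round is bounded by `min {1, B²}` alone. -/
theorem sum_le_of_potential {ρ w : ℕ → ℝ} {C' B δ : ℝ} {N d T : ℕ} (hC : 3 ≤ C') (hB : 0 < B)
    (hδ : 0 < δ) (hδ1 : δ < 1) (hN : 1 ≤ N) (hd : 1 ≤ d) (hT : 1 ≤ T) (hw : ∀ t, 0 ≤ w t)
    (hρ1 : ∀ t, ρ t ≤ 1) (hρB : ∀ t, ρ t ≤ B ^ 2)
    (hρw : ∀ t ∈ Finset.Icc 1 T,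
      ρ t ≤ 2 * (C' * (√(Real.log (t * N / δ)) + √(lam t) * B) * w t))
    (hpot : ∑ t ∈ Finset.Icc 1 T, min 1 (w t) ^ 2 ≤ 4 * d * Real.log (1 + T * B)) :
    ∑ t ∈ Finset.Icc 1 T, ρ t ≤
      (4 * C' + 2) * (B * √(T * d * Real.log (1 + T * B)) +
        √(T * d * Real.log (T * N / δ) * Real.log (1 + T * B))) := by
  have hN' : (1 : ℝ) ≤ N := mod_cast hN
  have hd' : (1 : ℝ) ≤ d := mod_cast hd
  have hT' : (1 : ℝ) ≤ T := mod_cast hT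
  set L := Real.log (T * N / δ) with hL
  set l := Real.log (1 + T * B) with hl
  have hl0 : 0 ≤ l := Real.log_nonneg (by nlinarith)
  set A := 2 * C' * (√L + B) with hA
  have hA0 : 0 ≤ A := by positivity
  set R := 2 * (B * √(T * d * l)) with hR
  have hR0 : 0 ≤ R := by positivity
  have hm0 : ∀ t, 0 ≤ min 1 (w t) := fun t => le_min zero_le_one (hw t)
  -- the first round
  have hfirst : ρ 1 ≤ R := by
    have hlB : Real.log (1 + B) ≤ T * d * l := by
      have h1 : Real.log (1 + B) ≤ l := Real.log_le_log (by positivity) (by nlinarith)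
      exact h1.trans (le_mul_of_one_le_left hl0 (one_le_mul_of_one_le_of_one_le hT' hd'))
    rcases le_total B 1 with hB1 | hB1
    · have h1 := Real.one_sub_inv_le_log_of_pos (x := 1 + B) (by positivity)
      have h2 : B / 2 ≤ 1 - (1 + B)⁻¹ := by
        have : 1 - (1 + B)⁻¹ = B / (1 + B) := by field_simp; ring
        rw [this]
        exact div_le_div_of_nonneg_left hB.le (by positivity) (by linarith)
      have h3 : B / 2 ≤ √(T * d * l) := Real.le_sqrt_of_sq_le (by nlinarith)
      refine (hρB 1).trans ?_
      rw [hR]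
      nlinarith
    · have h1 : Real.log 2 ≤ Real.log (1 + B) := Real.log_le_log (by norm_num) (by linarith)
      have h3 : 1 / 2 ≤ √(T * d * l) :=
        Real.le_sqrt_of_sq_le (by linarith [Real.log_two_gt_d9])
      refine (hρ1 1).trans ?_
      rw [hR]
      nlinarith
  have hterm : ∀ t ∈ Finset.Icc 1 T, ρ t ≤ (if t = 1 then R else 0) + A * min 1 (w t) := by
    intro t ht
    obtain ⟨ht1, htT⟩ := Finset.mem_Icc.1 ht
    rcases eq_or_ne t 1 with rfl | hne
    · rw [if_pos rfl]
      exact hfirst.trans (le_add_of_nonneg_right (mul_nonneg hA0 (hm0 _)))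
    rw [if_neg hne, zero_add]
    have ht1' : (1 : ℝ) ≤ t := mod_cast ht1
    have htT' : (t : ℝ) ≤ T := mod_cast htT
    rcases le_total 1 (w t) with h | h
    · rw [min_eq_left h, mul_one]
      have hT2 : (2 : ℝ) ≤ T := by exact_mod_cast (by omega : 2 ≤ T)
      have hL2 : Real.log 2 ≤ L := by
        refine Real.log_le_log (by norm_num) ((le_div_iff₀ hδ).2 ?_)
        nlinarith
      have h3 : 1 / 2 ≤ √L := Real.le_sqrt_of_sq_le (by linarith [Real.log_two_gt_d9])
      refine (hρ1 t).trans ?_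
      rw [hA]
      nlinarith
    · rw [min_eq_right h]
      refine (hρw t ht).trans ?_
      have h1 : √(Real.log (t * N / δ)) ≤ √L := by
        refine Real.sqrt_le_sqrt (Real.log_le_log (by positivity) ?_)
        gcongr
      have h2 : √(lam t) * B ≤ B :=
        mul_le_of_le_one_left hB.le (Real.sqrt_le_one.2 (lam_le_one ht1))
      calc _ = 2 * C' * (√(Real.log (t * N / δ)) + √(lam t) * B) * w t := by ring
        _ ≤ A * w t := by
          refine mul_le_mul_of_nonneg_right ?_ (hw t)
          exact mul_le_mul_of_nonneg_left (add_le_add h1 h2) (by positivity)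
  have hsum : ∑ t ∈ Finset.Icc 1 T, min 1 (w t) ≤ 2 * √(T * d * l) := by
    have h := sq_sum_le_card_mul_sum_sq (s := Finset.Icc 1 T) (f := fun t => min 1 (w t))
    rw [Nat.card_Icc, Nat.add_sub_cancel] at h
    refine abs_le_of_sq_le_sq' ?_ (by positivity) |>.2
    rw [mul_pow, Real.sq_sqrt (by positivity)]
    nlinarith [mul_le_mul_of_nonneg_left hpot (zero_le_one.trans hT')]
  have hLl : √(T * d * L * l) = √L * √(T * d * l) := by
    have hL0 : 0 ≤ L := Real.log_nonneg ((one_le_div hδ).2 (by nlinarith))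
    rw [← Real.sqrt_mul hL0]; ring_nf
  calc ∑ t ∈ Finset.Icc 1 T, ρ t
      ≤ ∑ t ∈ Finset.Icc 1 T, ((if t = 1 then R else 0) + A * min 1 (w t)) :=
        Finset.sum_le_sum hterm
    _ = R + A * ∑ t ∈ Finset.Icc 1 T, min 1 (w t) := by
        rw [Finset.sum_add_distrib, Finset.sum_ite_eq' (Finset.Icc 1 T) 1 fun _ => R,
          if_pos (Finset.mem_Icc.2 ⟨le_rfl, hT⟩), Finset.mul_sum]
    _ ≤ R + A * (2 * √(T * d * l)) := by gcongr
    _ ≤ _ := by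
        have h0 : 0 ≤ √L * √(T * d * l) := by positivity
        rw [hLl, hR, hA]
        linarith

end LORIL

theorem mainTheorem1 :
    ∃ C₀ : ℝ, 0 < C₀ ∧ ∀ C' : ℝ, C₀ ≤ C' → ∃ K : ℝ, 0 < K ∧
      ∀ (X Y S : Type*) [Fintype X] [Fintype Y] [Fintype S] [Nonempty Y]
        [MeasurableSpace X] [MeasurableSingletonClass X]
        [MeasurableSpace Y] [MeasurableSingletonClass Y]
        [MeasurableSpace S] [MeasurableSingletonClass S]
        (d : ℕ) (P : Y → S → PMF X)
        (F : Finset (X → EuclideanSpace ℝ (Fin d))) (g : Y → S → EuclideanSpace ℝ (Fin d))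
        (B δ : ℝ),
        0 < B → 0 < δ → δ < 1 →
        LORIL.Realizable P F g → LORIL.BoundedFeatures B F g →
        ∀ (Ω : Type*) (mΩ : MeasurableSpace Ω) (μ : MeasureTheory.Measure Ω)
          [MeasureTheory.IsProbabilityMeasure μ] (ℱ : MeasureTheory.Filtration ℕ mΩ)
          (I : LORIL.Interaction X Y S Ω),
          LORIL.IsProtocol μ ℱ P I → I.IsLORIL F g C' B δ →
          1 - 3 * δ ≤ μ.real {ω | ∀ T : ℕ, 1 ≤ T →
            I.regret P T ω ≤
              K * (B * √(T * d * Real.log (1 + T * B)) +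
                √(T * d * Real.log (T * F.card / δ) * Real.log (1 + T * B)))} := by
  refine ⟨3, by norm_num, fun C' hC => ⟨4 * C' + 2, by linarith, ?_⟩⟩
  intro X Y S _ _ _ _ _ _ _ _ _ _ d P F g B δ hB hδ hδ1 hreal hbd Ω mΩ μ _ ℱ I hI hLORIL
  obtain ⟨⟨fstar, hfstar, hP⟩, hF⟩ := hreal
  obtain ⟨fhat, hfhat⟩ := hLORIL
  have hprob := LORIL.one_sub_le_measureReal_confidenceEvent hI hfstar hP hF hδ hδ1
  refine (by linarith : 1 - 3 * δ ≤ 1 - 2 * δ).trans (hprob.trans (measureReal_mono ?_))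
  intro ω hω T hT
  have hd : 1 ≤ d := by
    -- in dimension zero all model values vanish, and so does their sum
    rcases Nat.eq_zero_or_pos d with rfl | h
    · exfalso
      have h := (hF fstar hfstar (I.y 0 ω) (I.s 0 ω)).2
      simp [Subsingleton.elim (g (I.y 0 ω) (I.s 0 ω)) 0] at h
    · exact h
  have hTr : (1 : ℝ) ≤ T := mod_cast hT
  set v : ℕ → EuclideanSpace ℝ (Fin d) := fun ℓ => g (I.y ℓ ω) (I.s ℓ ω) with hv
  have hle1 : ∀ y s x, (P y s x).toReal ≤ 1 := fun y s x =>
    ENNReal.toReal_le_of_le_ofReal zero_le_one (by simpa using (P y s).coe_le_one x)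
  have hleB : ∀ y s x, (P y s x).toReal ≤ B ^ 2 := fun y s x => by
    rw [hP, sq]
    exact (real_inner_le_norm _ _).trans
      (mul_le_mul (hbd.1 fstar hfstar x) (hbd.2 y s) (norm_nonneg _) hB.le)
  rw [LORIL.Interaction.regret]
  -- the regularizers `λ_t` are replaced by the smallest one, `λ_T`
  refine LORIL.sum_le_of_potential
    (w := fun t => LORIL.matNorm (LORIL.covariance (LORIL.lam T) v t)⁻¹ (v t)) hC hB hδ hδ1
    (Finset.card_pos.2 ⟨fstar, hfstar⟩) hd hT (fun t => Real.sqrt_nonneg _) (fun t => ?_)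
    (fun t => ?_) (fun t ht => ?_) ?_
  · exact (sub_le_self _ ENNReal.toReal_nonneg).trans (Finset.sup'_le _ _ fun y _ => hle1 _ _ _)
  · exact (sub_le_self _ ENNReal.toReal_nonneg).trans (Finset.sup'_le _ _ fun y _ => hleB _ _ _)
  · obtain ⟨ht1, htT⟩ := Finset.mem_Icc.1 ht
    obtain ⟨hfF, hmle, hopt⟩ := hfhat t ht1 ω
    have herr := fun y => LORIL.abs_inner_sub_le_bonus hC hB hδ ht1 hbd hfstar hfF hω
      (hmle fstar hfstar) (I.x t ω) y (I.s t ω)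
    simp only [inner_sub_left, abs_le] at herr
    have hreg : Finset.univ.sup' Finset.univ_nonempty
          (fun y : Y => (P y (I.s t ω) (I.x t ω)).toReal) -
        (P (I.y t ω) (I.s t ω) (I.x t ω)).toReal ≤
          2 * I.bonus g C' B δ F.card t ω (I.y t ω) (I.s t ω) := by
      rw [sub_le_iff_le_add]
      refine Finset.sup'_le _ _ fun y _ => ?_
      rw [hP, hP]
      linarith [(herr y).1, (herr (I.y t ω)).2, hopt y]
    refine hreg.trans (mul_le_mul_of_nonneg_left ?_ zero_le_two)
    have hlam := LORIL.lam_pos ht1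
    refine mul_le_mul_of_nonneg_left ?_ (by positivity)
    exact LORIL.matNorm_inv_le_of_le (LORIL.covariance_posDef (LORIL.lam_pos hT) v t)
      (LORIL.covariance_posDef hlam v t)
      (LORIL.covariance_quadForm_mono (LORIL.lam_anti ht1 htT) v t) _
  · refine (LORIL.sum_min_one_sq_matNorm_le (LORIL.lam_pos hT) hd v (fun ℓ => hbd.2 _ _) T).trans ?_
    have hTB : 0 < T * B := by positivity
    have h1 : 1 + T * B ^ 2 / LORIL.lam T ≤ (1 + T * B) ^ 2 := by
      rw [LORIL.lam, div_div_eq_mul_div, div_one]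
      nlinarith
    have h2 := Real.log_le_log (by have := LORIL.lam_pos hT; positivity) h1
    rw [Real.log_pow] at h2
    push_cast at h2
    have hd0 : (0 : ℝ) ≤ 2 * d := by positivity
    nlinarith [mul_le_mul_of_nonneg_left h2 hd0]
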